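/- Let $S^1=\mathbb R/\mathbb Z$ with its standard (Lebesgue/Haar) probability measure $\mu$. A continuous map $g\colon S^1\to S^1$ is called monotone of degree one if it has a continuous nondecreasing lift $F\colon\mathbb R\to\mathbb R$ with $F(x+1)=F(x)+1$; its rotation number is $\lim_{n\to\infty}F^n(x)/n$ modulo $1$, taken in $[0,1)$. A homeomorphism of $S^1$ is orientation preserving if it is monotone of degree one. Write $(x,y)$ for the open arc of $S^1$ that starts at $x$ and goes in the positive direction ending at $y$. For a system $\mathcal I$ of measurable subsets of a probability space $(\Omega,\pi)$, $0<\lambda<1$ and $\ell\ge 1$, let $N_\ell(\mathcal I,\pi,\lambda)\in\{1,2,\dots\}\cup\{\infty\}$ be the minimum number of boxes $J_1\times\cdots\times J_\ell$ with $J_1,\dots,J_\ell\in\mathcal I$ whose union has $\pi^\ell$-measure at least $1-\lambda$. Let $\underline H_\lambda(\mathcal I,\pi)$ and $\overline H_\lambda(\mathcal I,\pi)$ be the $\liminf$ and the $\limsup$ of $\frac1\ell\log N_\ell(\mathcal I,\pi,\lambda)$ as $\ell\to\infty$. The entropy $H(\mathcal I,\pi)$ exists and equals $h\in[0,\infty]$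 if $\underline H_\lambda(\mathcal I,\pi)=\overline H_\lambda(\mathcal I,\pi)=h$ for all $0<\lambda<1$. **Proposition.** Let $f\colon S^1\to S^1$ be an orientation-preserving homeomorphism whose rotation number $\alpha\in(0,1)$ is irrational, and let $\mathcal I_f=\{(x,f(x)) : x\in S^1\}$. Then there exists a continuous monotone map $G\colon S^1\to S^1$ of degree one with $$G(f(x))=G(x)+\alpha \pmod 1\quad\text{for all }x\in S^1.$$ Moreover, every such $G$ is differentiable $\mu$-almost everywhere, $\int\max(\log G',0)\,d\mu<\infty$, so that $\int\log G'\,d\mu\in[-\infty,\infty)$ is well defined (with $\log 0=-\infty$), and $$\underline H_\lambda(\mathcal I_f,\mu)\ \ge\ \int\log G'\,d\mu-\log\alpha\qquad\text{for every }0<\lambda<1.$$ In particular, $H(\mathcal I_f,\mu)\ge\int\log G'\,d\mu-\log\alpha$ whenever the entropy $H(\mathcal I_f,\mu)$ exists. -/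

import Mathlib

open MeasureTheory Filter Topology

noncomputable section

namespace ArcEntropy

/-! ### Entropy of a set system -/

section Entropy

variable {Ω : Type*} [MeasurableSpace Ω]

/-- `B` is an `l`-dimensional `I`-box: a product `J 0 × ⋯ × J (l - 1)` of members of `I`. -/
def IsBox (I : Set (Set Ω)) (l : ℕ) (B : Set (Fin l → Ω)) : Prop :=
  ∃ J : Fin l → Set Ω, (∀ i, J i ∈ I) ∧ B = Set.univ.pi J

/-- The minimum number of `l`-dimensional `I`-boxes whose union has measure at least `1 - lam`
for the `l`-fold product of `P`; it is `⊤` if no finite number of boxes suffices. -/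
def coveringNumber (I : Set (Set Ω)) (P : Measure Ω) (lam : ℝ) (l : ℕ) : ℕ∞ :=
  sInf {n : ℕ∞ | ∃ C : Finset (Set (Fin l → Ω)), (∀ B ∈ C, IsBox I l B) ∧
    ENNReal.ofReal (1 - lam) ≤ Measure.pi (fun _ : Fin l => P) (⋃ B ∈ C, B) ∧
    n = (C.card : ℕ∞)}

/-- The rate `(1 / l) * log N`, where `N` is the covering number in dimension `l`. -/
def rate (I : Set (Set Ω)) (P : Measure Ω) (lam : ℝ) (l : ℕ) : EReal :=
  ENNReal.log (coveringNumber I P lam l : ENNReal) / (l : EReal)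

/-- The lower entropy of `(I, P)` at level `lam`. -/
def lowerEntropy (I : Set (Set Ω)) (P : Measure Ω) (lam : ℝ) : EReal :=
  liminf (fun l : ℕ => rate I P lam l) atTop

/-- The upper entropy of `(I, P)` at level `lam`. -/
def upperEntropy (I : Set (Set Ω)) (P : Measure Ω) (lam : ℝ) : EReal :=
  limsup (fun l : ℕ => rate I P lam l) atTop

/-- The entropy of `(I, P)` exists and is equal to `h`. -/
def HasEntropy (I : Set (Set Ω)) (P : Measure Ω) (h : EReal) : Prop :=
  ∀ lam : ℝ, 0 < lam → lam < 1 → lowerEntropy I P lam = h ∧ upperEntropy I P lam = h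

/-- The integral of the positive part of `log g`, where `log 0 = -∞`. -/
def posLogIntegral (P : Measure Ω) (g : Ω → ℝ) : ENNReal :=
  ∫⁻ x, (ENNReal.log (ENNReal.ofReal (g x))).toENNReal ∂P

/-- The integral of the negative part of `log g`, where `log 0 = -∞`. -/
def negLogIntegral (P : Measure Ω) (g : Ω → ℝ) : ENNReal :=
  ∫⁻ x, (-ENNReal.log (ENNReal.ofReal (g x))).toENNReal ∂P

/-- The integral of `log g` for `g ≥ 0`, with `log 0 = -∞`, as an extended real number. It is
meaningful as soon as the positive part has finite integral. -/
def logIntegral (P : Measure Ω) (g : Ω → ℝ) : EReal :=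
  (posLogIntegral P g : EReal) - (negLogIntegral P g : EReal)

end Entropy

/-! ### Maps of the circle `ℝ / ℤ` -/

/-- The nondecreasing map `F : ℝ → ℝ` with `F (x + 1) = F x + 1` is a continuous lift of `g`. -/
def IsLift (F : CircleDeg1Lift) (g : UnitAddCircle → UnitAddCircle) : Prop :=
  Continuous F ∧ ∀ x : ℝ, ((F x : ℝ) : UnitAddCircle) = g (x : UnitAddCircle)

/-- `g` is a continuous monotone map of the circle of degree one. For a homeomorphism `g` this says
that `g` preserves the orientation. -/
def IsMonotoneDegreeOne (g : UnitAddCircle → UnitAddCircle) : Prop :=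
  ∃ F : CircleDeg1Lift, IsLift F g

/-- The rotation number, in `[0, 1)`: the fractional part of the limit of `F^n(x) / n` for a
lift `F`. -/
def rotationNumber {g : UnitAddCircle → UnitAddCircle} (hg : IsMonotoneDegreeOne g) : ℝ :=
  Int.fract (CircleDeg1Lift.translationNumber hg.choose)

/-- Two continuous lifts of the same map differ by an integer. -/
theorem IsLift.exists_int {g : UnitAddCircle → UnitAddCircle} {F₁ F₂ : CircleDeg1Lift}
    (h₁ : IsLift F₁ g) (h₂ : IsLift F₂ g) : ∃ m : ℤ, ∀ x, F₁ x = F₂ x + m := by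
  have key : ∀ x : ℝ, ∃ m : ℤ, (m : ℝ) = F₁ x - F₂ x := by
    intro x
    have h : ((F₁ x - F₂ x : ℝ) : UnitAddCircle) = 0 := by
      rw [AddCircle.coe_sub, h₁.2, h₂.2, sub_self]
    obtain ⟨m, hm⟩ := AddCircle.coe_eq_zero_iff (1 : ℝ) |>.1 h
    exact ⟨m, by simpa using hm⟩
  have hd : IsDiscrete (Set.range ((↑) : ℤ → ℝ)) := by
    rw [isDiscrete_iff_discreteTopology]
    exact Int.isClosedEmbedding_coe_real.isEmbedding.toHomeomorph.symm.isEmbedding.discreteTopology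
  obtain ⟨m, hm⟩ := key 0
  refine ⟨m, fun x => ?_⟩
  have hc : Continuous fun x => F₁ x - F₂ x := h₁.1.sub h₂.1
  have hx := isPreconnected_univ.constant_of_mapsTo hd hc.continuousOn
    (fun x _ => key x) (Set.mem_univ x) (Set.mem_univ 0)
  simp only [← hm] at hx
  linarith

/-- The rotation number does not depend on the lift. -/
theorem rotationNumber_eq {g : UnitAddCircle → UnitAddCircle} (hg : IsMonotoneDegreeOne g)
    {F : CircleDeg1Lift} (hF : IsLift F g) :
    rotationNumber hg = Int.fract (CircleDeg1Lift.translationNumber F) := by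
  obtain ⟨m, hm⟩ := IsLift.exists_int hg.choose_spec hF
  have h : hg.choose = CircleDeg1Lift.translate (Multiplicative.ofAdd (m : ℝ)) * F := by
    ext x
    simp [hm x, add_comm]
  have hcomm : Commute (CircleDeg1Lift.translate (Multiplicative.ofAdd (m : ℝ)) : CircleDeg1Lift)
      F := by
    ext x
    simp [add_comm]
  rw [rotationNumber, h, CircleDeg1Lift.translationNumber_mul_of_commute hcomm,
    CircleDeg1Lift.translationNumber_translate, Int.fract_intCast_add]

/-- The signed displacement of `g` from `x`: the representative in `(-1/2, 1/2]` of
`g (x + t) - g x`, for a real number `t`. -/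
def displacement (g : UnitAddCircle → UnitAddCircle) (x : UnitAddCircle) (t : ℝ) : ℝ :=
  (AddCircle.equivIoc (1 : ℝ) (-1 / 2) (g (x + (t : UnitAddCircle)) - g x) : ℝ)

/-- Differentiability of a circle map at a point. -/
def CircleDifferentiableAt (g : UnitAddCircle → UnitAddCircle) (x : UnitAddCircle) : Prop :=
  DifferentiableAt ℝ (displacement g x) 0

/-- The derivative of a circle map at a point (`0` where it is not differentiable). -/
def circleDeriv (g : UnitAddCircle → UnitAddCircle) (x : UnitAddCircle) : ℝ :=
  deriv (displacement g x) 0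

/-- Near `0`, the displacement is the increment of any lift. -/
theorem displacement_eventuallyEq {g : UnitAddCircle → UnitAddCircle} {F : CircleDeg1Lift}
    (hF : IsLift F g) (x : ℝ) :
    displacement g (x : UnitAddCircle) =ᶠ[𝓝 0] fun t => F (x + t) - F x := by
  have hc : ContinuousAt (fun t : ℝ => F (x + t) - F x) 0 :=
    ((hF.1.comp (continuous_const.add continuous_id)).sub continuous_const).continuousAt
  have h0 : Set.Ioo (-1 / 2 : ℝ) (1 / 2) ∈ 𝓝 (F (x + 0) - F x) := by
    rw [add_zero, sub_self]
    exact Ioo_mem_nhds (by norm_num) (by norm_num)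
  filter_upwards [hc h0] with t ht
  have ht' : F (x + t) - F x ∈ Set.Ioc (-1 / 2 : ℝ) (-1 / 2 + 1) :=
    ⟨ht.1, by linarith [ht.2]⟩
  have h : g ((x : UnitAddCircle) + (t : UnitAddCircle)) - g (x : UnitAddCircle) =
      ((F (x + t) - F x : ℝ) : UnitAddCircle) := by
    rw [AddCircle.coe_sub, hF.2, hF.2, AddCircle.coe_add]
  rw [displacement, h, AddCircle.equivIoc_coe_eq ht']

/-- The derivative of a circle map is the derivative of any lift. -/
theorem circleDeriv_coe {g : UnitAddCircle → UnitAddCircle} {F : CircleDeg1Lift}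
    (hF : IsLift F g) (x : ℝ) : circleDeriv g (x : UnitAddCircle) = deriv F x := by
  rw [circleDeriv, (displacement_eventuallyEq hF x).deriv_eq, deriv_sub_const,
    deriv_comp_const_add, add_zero]

/-- The system of the open arcs `(x, f x)`, starting at `x` and going in the positive direction
until `f x`. -/
def arcSystem (f : UnitAddCircle → UnitAddCircle) : Set (Set UnitAddCircle) :=
  {J | ∃ x : UnitAddCircle, J = Set.cIoo x (f x)}

/-- The open arc from `x` to `x + s`, for `0 < s < 1`, is the image of an open interval. -/
theorem cIoo_coe (x s : ℝ) (hs : 0 < s) (hs' : s < 1) :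
    Set.cIoo (x : UnitAddCircle) ((x + s : ℝ) : UnitAddCircle) =
      ((↑) : ℝ → UnitAddCircle) '' Set.Ioo x (x + s) := by
  have hs1 : toIcoMod (zero_lt_one' ℝ) 0 (x + s - x) = s := by
    rw [add_sub_cancel_left, toIcoMod_eq_self]
    exact ⟨hs.le, by linarith⟩
  have hiff : ∀ z : ℝ, (z : UnitAddCircle) ∈
      Set.cIoo (x : UnitAddCircle) ((x + s : ℝ) : UnitAddCircle) ↔
      toIocMod (zero_lt_one' ℝ) 0 (z - x) < s := by
    intro z
    rw [Set.mem_cIoo, sbtw_iff_not_btw, btw_cyclic, QuotientAddGroup.btw_coe_iff',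
      hs1, not_le]
  ext w
  obtain ⟨z, rfl⟩ := QuotientAddGroup.mk_surjective w
  constructor
  · intro h
    have h' := (hiff z).1 h
    have hpos := left_lt_toIocMod (zero_lt_one' ℝ) 0 (z - x)
    refine ⟨x + toIocMod (zero_lt_one' ℝ) 0 (z - x), ⟨by linarith, by linarith⟩, ?_⟩
    rw [AddCircle.coe_add, toIocMod, AddCircle.coe_sub, AddCircle.coe_zsmul,
      AddCircle.coe_period, smul_zero, sub_zero, ← AddCircle.coe_add]
    congr 1
    ring
  · rintro ⟨y, ⟨h1, h2⟩, hy⟩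
    rw [← hy]
    refine (hiff y).2 ?_
    rw [(toIocMod_eq_self (zero_lt_one' ℝ)).2 ⟨by linarith, by linarith⟩]
    linarith

/-- `G` is a monotone semiconjugacy from `f` to the rotation by `α`: a continuous monotone
degree one map of the circle with `G (f x) = G x + α`. -/
def IsMonotoneSemiconjugacy (f : UnitAddCircle → UnitAddCircle) (α : ℝ)
    (G : UnitAddCircle → UnitAddCircle) : Prop :=
  IsMonotoneDegreeOne G ∧ ∀ x, G (f x) = G x + (α : UnitAddCircle)

end ArcEntropy

end

/-! The derivative `G'` serves as a density. For suitable lifts `F`, `Γ` of `f`, `G` one has `Γ ∘ F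
= Γ + α`, so `Γ` grows by exactly `α` along each arc `(x, f x)`. The derivative of a monotone
function integrates to at most the increment, hence every arc has `G'`-mass at most `α`, and every
`l`-dimensional box has mass at most `α ^ l` for the product density `∏ G' (ω i)`. By the law of
large numbers this product density is at least `exp (l (∫ log G' - ε))` outside a set of small
measure. A union of boxes of measure at least `1 - λ` therefore has density mass at least a constant
times that exponential, and at least that mass divided by `α ^ l` boxes are needed.
`le_lowerEntropy_of_density` carries out this count for any density and any set system. For the
existence of `G`, equality of translation numbers yields a monotone semiconjugacy between lifts. Its
range is invariant under the dense group `ℤ + αℤ`, and a monotone map with dense range is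
continuous. -/

namespace ArcEntropy

open ProbabilityTheory

/-! ### The entropy bound from a density -/

section Density

variable {Ω : Type*} [MeasurableSpace Ω]

/-- The weak law of large numbers (lower deviations) on finite products. -/
theorem tendsto_pi_sum_lt (P : Measure Ω) [IsProbabilityMeasure P] {X : Ω → ℝ}
    (hX : Measurable X) (hint : Integrable X P) {ε : ℝ} (hε : 0 < ε) :
    Tendsto (fun l : ℕ => Measure.pi (fun _ : Fin l => P)
      {ω | ∑ i, X (ω i) < l * (∫ x, X x ∂P - ε)}) atTop (𝓝 0) := by
  -- All the finite products are marginals of one infinite product, where the strong law applies;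
  -- almost sure convergence then gives convergence in measure.
  let Q : Measure (ℕ → Ω) := Measure.infinitePi (fun _ : ℕ => P)
  have hmp (i : ℕ) : MeasurePreserving (fun ω : ℕ → Ω => ω i) Q P :=
    measurePreserving_eval_infinitePi (fun _ : ℕ => P) i
  have hind : iIndepFun (fun (i : ℕ) (ω : ℕ → Ω) => X (ω i)) Q :=
    iIndepFun_infinitePi (P := fun _ : ℕ => P) (X := fun _ => X) (fun _ => hX)
  have hslln := strong_law_ae_real (μ := Q) (fun i ω => X (ω i))
    ((hmp 0).integrable_comp_of_integrable hint) (fun i j hij => hind.indepFun hij)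
    (fun i => ⟨(hX.comp (measurable_pi_apply i)).aemeasurable,
      (hX.comp (measurable_pi_apply 0)).aemeasurable, by
        change Measure.map (X ∘ fun ω : ℕ → Ω => ω i) Q = Measure.map (X ∘ fun ω : ℕ → Ω => ω 0) Q
        rw [← Measure.map_map hX (measurable_pi_apply i),
          ← Measure.map_map hX (measurable_pi_apply 0), (hmp i).map_eq, (hmp 0).map_eq]⟩)
  have hEX : ∫ ω, X (ω 0) ∂Q = ∫ x, X x ∂P :=
    (hmp 0).hasLaw.integral_comp hX.aestronglyMeasurable
  rw [hEX] at hslln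
  have hmeas (n : ℕ) : Measurable fun ω : ℕ → Ω => (∑ i ∈ Finset.range n, X (ω i)) / n :=
    (Finset.measurable_sum _ fun i _ => hX.comp (measurable_pi_apply i)).div_const _
  have htm := tendstoInMeasure_of_tendsto_ae (fun n => (hmeas n).aestronglyMeasurable) hslln
  rw [tendstoInMeasure_iff_dist] at htm
  refine tendsto_of_tendsto_of_tendsto_of_le_of_le tendsto_const_nhds (htm ε hε)
    (fun _ => zero_le) fun l => ?_
  have hfin : Measure.map (fun (ω : ℕ → Ω) (i : Fin l) => ω i) Q =
      Measure.pi (fun _ : Fin l => P) := by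
    rw [← Measure.infinitePi_eq_pi]
    exact Measure.map_infinitePi_infinitePi_of_inj (P := fun _ : ℕ => P) Fin.val_injective
  have hset : MeasurableSet {ω : Fin l → Ω | ∑ i, X (ω i) < l * (∫ x, X x ∂P - ε)} :=
    measurableSet_lt (Finset.measurable_sum _ fun i _ => hX.comp (measurable_pi_apply i))
      measurable_const
  change Measure.pi (fun _ : Fin l => P) _ ≤ _
  rw [← hfin, Measure.map_apply (by fun_prop) hset]
  refine measure_mono fun ω hω => ?_
  simp only [Set.mem_preimage, Set.mem_ofPred_eq] at hω ⊢
  rw [Fin.sum_univ_eq_sum_range (fun i => X (ω i))] at hω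
  rcases Nat.eq_zero_or_pos l with rfl | hl
  · simp at hω
  have hl' : (0 : ℝ) < l := by exact_mod_cast hl
  have : (∑ i ∈ Finset.range l, X (ω i)) / l < ∫ x, X x ∂P - ε := by
    rw [div_lt_iff₀ hl']; linarith
  rw [dist_comm, Real.dist_eq]
  exact le_trans (by linarith) (le_abs_self _)

theorem lintegral_pi_prod (P : Measure Ω) [IsProbabilityMeasure P] {l : ℕ}
    {φ : Fin l → Ω → ENNReal} (hφ : ∀ i, Measurable (φ i)) :
    ∫⁻ ω, ∏ i, φ i (ω i) ∂(Measure.pi fun _ : Fin l => P) = ∏ i, ∫⁻ x, φ i x ∂P := by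
  rw [lintegral_prod_eq_prod_lintegral_of_indepFun Finset.univ
    (fun (i : Fin l) (ω : Fin l → Ω) => φ i (ω i))
    (iIndepFun_pi (μ := fun _ : Fin l => P) (X := φ) fun i => (hφ i).aemeasurable)
    (fun i => (hφ i).comp (measurable_pi_apply i))]
  exact Finset.prod_congr rfl fun i _ =>
    (measurePreserving_eval (fun _ : Fin l => P) i).lintegral_comp (hφ i)

/-- If every member of `I` has mass at most `a` for the density `φ`, then every box has mass at
most `a ^ l` for the product density. -/
theorem setLIntegral_box_le {I : Set (Set Ω)} (P : Measure Ω) [IsProbabilityMeasure P]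
    {φ : Ω → ENNReal} (hφ : Measurable φ) {a : ENNReal}
    (hI : ∀ J ∈ I, MeasurableSet J ∧ ∫⁻ x in J, φ x ∂P ≤ a) {l : ℕ} {B : Set (Fin l → Ω)}
    (hB : IsBox I l B) :
    MeasurableSet B ∧ ∫⁻ ω in B, ∏ i, φ (ω i) ∂(Measure.pi fun _ : Fin l => P) ≤ a ^ l := by
  obtain ⟨J, hJ, rfl⟩ := hB
  have hm : MeasurableSet (Set.univ.pi J) := MeasurableSet.univ_pi fun i => (hI _ (hJ i)).1
  refine ⟨hm, ?_⟩
  -- The indicator of a box is the product of the indicators of its sides, so the integral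
  -- factorizes.
  have hind : (Set.univ.pi J).indicator (fun ω => ∏ i, φ (ω i)) =
      fun ω : Fin l → Ω => ∏ i, (J i).indicator φ (ω i) := by
    ext ω
    by_cases h : ω ∈ Set.univ.pi J
    · rw [Set.indicator_of_mem h]
      exact Finset.prod_congr rfl fun i _ => (Set.indicator_of_mem (h i trivial) φ).symm
    · rw [Set.indicator_of_notMem h]
      obtain ⟨i, hi⟩ : ∃ i, ω i ∉ J i := by simpa [Set.mem_univ_pi] using h
      exact (Finset.prod_eq_zero (Finset.mem_univ i) (Set.indicator_of_notMem hi φ)).symm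
  rw [← lintegral_indicator hm, hind,
    lintegral_pi_prod P fun i => hφ.indicator (hI _ (hJ i)).1]
  calc ∏ i, ∫⁻ x, (J i).indicator φ x ∂P ≤ ∏ _i : Fin l, a := by
        refine Finset.prod_le_prod' fun i _ => ?_
        rw [lintegral_indicator (hI _ (hJ i)).1]
        exact (hI _ (hJ i)).2
    _ = a ^ l := by simp

/-- A lower bound for all admissible cardinalities bounds the covering number. -/
theorem le_coveringNumber {I : Set (Set Ω)} {P : Measure Ω} {lam : ℝ} {l : ℕ} {b : ENNReal}
    (h : ∀ C : Finset (Set (Fin l → Ω)), (∀ B ∈ C, IsBox I l B) →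
      ENNReal.ofReal (1 - lam) ≤ Measure.pi (fun _ : Fin l => P) (⋃ B ∈ C, B) →
      b ≤ (C.card : ENNReal)) : b ≤ (coveringNumber I P lam l : ENNReal) := by
  rcases Set.eq_empty_or_nonempty {n : ℕ∞ | ∃ C : Finset (Set (Fin l → Ω)),
    (∀ B ∈ C, IsBox I l B) ∧
    ENNReal.ofReal (1 - lam) ≤ Measure.pi (fun _ : Fin l => P) (⋃ B ∈ C, B) ∧
    n = (C.card : ℕ∞)} with he | hne
  · simp [coveringNumber, he]
  · obtain ⟨C, hC, hm, hn⟩ := csInf_mem hne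
    rw [coveringNumber, hn]
    simpa using h C hC hm

/-- A lower bound for the covering number, in terms of the measure of the set on which the product
density is small. -/
theorem le_coveringNumber_of_density {I : Set (Set Ω)} (P : Measure Ω) [IsProbabilityMeasure P]
    {φ : Ω → ENNReal} (hφ : Measurable φ) {a : ENNReal}
    (hI : ∀ J ∈ I, MeasurableSet J ∧ ∫⁻ x in J, φ x ∂P ≤ a) {l : ℕ} {lam : ℝ} {b δ : ENNReal}
    (hδ : Measure.pi (fun _ : Fin l => P) {ω | ∏ i, φ (ω i) < b} ≤ δ) :
    b * (ENNReal.ofReal (1 - lam) - δ) / a ^ l ≤ (coveringNumber I P lam l : ENNReal) := by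
  refine le_coveringNumber fun C hC hm => ?_
  refine ENNReal.div_le_of_le_mul ?_
  set Q := Measure.pi (fun _ : Fin l => P)
  set U := ⋃ B ∈ C, B
  have hA : MeasurableSet {ω : Fin l → Ω | ∏ i, φ (ω i) < b} :=
    measurableSet_lt (Finset.measurable_prod _ fun i _ => hφ.comp (measurable_pi_apply i))
      measurable_const
  set A := {ω : Fin l → Ω | ∏ i, φ (ω i) < b}
  have hU : MeasurableSet U :=
    C.measurableSet_biUnion fun B hB => (setLIntegral_box_le P hφ hI (hC B hB)).1
  -- The density is at least `b` on `U \ A`, and its integral over `U` is at most the sum over the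
  -- boxes.
  calc b * (ENNReal.ofReal (1 - lam) - δ) ≤ b * Q (U \ A) := by
        gcongr
        exact (tsub_le_tsub hm hδ).trans le_measure_sdiff
    _ = ∫⁻ _ in U \ A, b ∂Q := by simp
    _ ≤ ∫⁻ ω in U \ A, ∏ i, φ (ω i) ∂Q :=
        setLIntegral_mono' (hU.diff hA) fun ω hω => not_lt.1 hω.2
    _ ≤ ∫⁻ ω in U, ∏ i, φ (ω i) ∂Q := lintegral_mono_set Set.sdiff_subset
    _ ≤ ∑ B ∈ C, ∫⁻ ω in B, ∏ i, φ (ω i) ∂Q := by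
        have := lintegral_iUnion_le (μ := Q) (fun B : C => (B : Set (Fin l → Ω)))
          (fun ω => ∏ i, φ (ω i))
        rw [tsum_fintype, Finset.sum_coe_sort C (fun B => ∫⁻ ω in B, ∏ i, φ (ω i) ∂Q)] at this
        rwa [Set.iUnion_subtype] at this
    _ ≤ ∑ _B ∈ C, a ^ l := Finset.sum_le_sum fun B hB => (setLIntegral_box_le P hφ hI (hC B hB)).2
    _ = C.card * a ^ l := by simp

/-- When both parts have finite integral, `logIntegral` is the Bochner integral of `log g`. -/
theorem logIntegral_eq_integral {P : Measure Ω} {g : Ω → ℝ} (hg : Measurable g)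
    (hpos : posLogIntegral P g ≠ ⊤) (hneg : negLogIntegral P g ≠ ⊤) :
    (∀ᵐ x ∂P, 0 < g x) ∧ Integrable (fun x => Real.log (g x)) P ∧
      logIntegral P g = ((∫ x, Real.log (g x) ∂P : ℝ) : EReal) := by
  have hmn : Measurable fun x => (-ENNReal.log (ENNReal.ofReal (g x))).toENNReal :=
    (measurable_ereal_toENNReal.comp
      (ENNReal.measurable_log.comp hg.ennreal_ofReal).neg)
  -- The extended logarithm is `-∞` wherever `g ≤ 0`, so a finite negative part leaves only a null
  -- set there; elsewhere it agrees with `Real.log`.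
  have hgpos : ∀ᵐ x ∂P, 0 < g x := by
    filter_upwards [ae_lt_top hmn hneg] with x hx
    by_contra h
    rw [ENNReal.ofReal_of_nonpos (not_lt.1 h)] at hx
    simp at hx
  have h1 : posLogIntegral P g = ∫⁻ x, ENNReal.ofReal (Real.log (g x)) ∂P := by
    refine lintegral_congr_ae ?_
    filter_upwards [hgpos] with x hx
    rw [ENNReal.log_ofReal_of_pos hx, EReal.toENNReal_of_ne_top (EReal.coe_ne_top _),
      EReal.toReal_coe]
  have h2 : negLogIntegral P g = ∫⁻ x, ENNReal.ofReal (-Real.log (g x)) ∂P := by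
    refine lintegral_congr_ae ?_
    filter_upwards [hgpos] with x hx
    rw [ENNReal.log_ofReal_of_pos hx, ← EReal.coe_neg,
      EReal.toENNReal_of_ne_top (EReal.coe_ne_top _), EReal.toReal_coe]
  have hint : Integrable (fun x => Real.log (g x)) P := by
    refine ⟨(Real.measurable_log.comp hg).aestronglyMeasurable, ?_⟩
    have hle : ∫⁻ x, ‖Real.log (g x)‖ₑ ∂P ≤ posLogIntegral P g + negLogIntegral P g := by
      rw [h1, h2, ← lintegral_add_left hg.log.ennreal_ofReal]
      refine lintegral_mono fun x => ?_
      rw [Real.enorm_eq_ofReal_abs]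
      rcases abs_cases (Real.log (g x)) with h | h <;> rw [h.1]
      · exact le_self_add
      · exact le_add_self
    exact hle.trans_lt (ENNReal.add_lt_top.2 ⟨hpos.lt_top, hneg.lt_top⟩)
  refine ⟨hgpos, hint, ?_⟩
  rw [integral_eq_lintegral_pos_part_sub_lintegral_neg_part hint, ← h1, ← h2, logIntegral,
    EReal.coe_sub, EReal.coe_ennreal_toReal hpos, EReal.coe_ennreal_toReal hneg]

/-- If every member of `I` has mass at most `a` for the density `g`, then the lower entropy is at
least `∫ log g - log a`. -/
theorem le_lowerEntropy_of_density {I : Set (Set Ω)} (P : Measure Ω) [IsProbabilityMeasure P]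
    {g : Ω → ℝ} (hg : Measurable g) {a : ℝ} (ha : 0 < a)
    (hI : ∀ J ∈ I, MeasurableSet J ∧ ∫⁻ x in J, ENNReal.ofReal (g x) ∂P ≤ ENNReal.ofReal a)
    (hpos : posLogIntegral P g ≠ ⊤) {lam : ℝ} (hlam : lam < 1) :
    logIntegral P g - (Real.log a : EReal) ≤ lowerEntropy I P lam := by
  by_cases hneg : negLogIntegral P g = ⊤
  · have : logIntegral P g = ⊥ := by
      rw [logIntegral, hneg, EReal.coe_ennreal_top, EReal.sub_top]
    rw [this, EReal.bot_sub]
    exact bot_le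
  obtain ⟨hgpos, hint, heq⟩ := logIntegral_eq_integral hg hpos hneg
  rw [heq, ← EReal.coe_sub]
  set L := ∫ x, Real.log (g x) ∂P with hL
  refine EReal.ge_of_forall_gt_iff_ge.1 fun z hz => ?_
  have hz' : z < L - Real.log a := by exact_mod_cast hz
  -- Half of the gap is spent on the law of large numbers, the other half absorbs `log c / l`.
  set ε := (L - Real.log a - z) / 2 with hε_def
  have hε : 0 < ε := by rw [hε_def]; linarith
  -- The exceptional set has measure at most `c`, which leaves `1 - lam - c = c` of the covered set.
  set c := (1 - lam) / 2 with hc_def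
  have hc : 0 < c := by rw [hc_def]; linarith
  refine le_liminf_of_le (by isBoundedDefault) ?_
  have hlog : ∀ᶠ l : ℕ in atTop, -ε < Real.log c / l :=
    (tendsto_const_div_atTop_nhds_zero_nat (Real.log c)).eventually (lt_mem_nhds (by linarith))
  have hδ : ∀ᶠ l : ℕ in atTop, Measure.pi (fun _ : Fin l => P)
      {ω | ∑ i, Real.log (g (ω i)) < l * (L - ε)} < ENNReal.ofReal c :=
    (tendsto_pi_sum_lt P (Real.measurable_log.comp hg) hint hε).eventually
      (gt_mem_nhds (by simpa using hc))
  filter_upwards [hlog, hδ, eventually_gt_atTop 0] with l hl1 hl2 hl3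
  have hl : (0 : ℝ) < l := by exact_mod_cast hl3
  have hsub : Measure.pi (fun _ : Fin l => P)
      {ω | ∏ i, ENNReal.ofReal (g (ω i)) < ENNReal.ofReal (Real.exp (l * (L - ε)))} ≤
      ENNReal.ofReal c := by
    refine (measure_mono_ae ?_).trans hl2.le
    have hall : ∀ᵐ ω ∂(Measure.pi fun _ : Fin l => P), ∀ i, 0 < g (ω i) :=
      ae_all_iff.2 fun i => (Measure.quasiMeasurePreserving_eval (fun _ : Fin l => P) i).ae hgpos
    filter_upwards [hall] with ω hω h
    change ∏ i, ENNReal.ofReal (g (ω i)) < ENNReal.ofReal (Real.exp (l * (L - ε))) at h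
    change ∑ i, Real.log (g (ω i)) < l * (L - ε)
    rw [← ENNReal.ofReal_prod_of_nonneg fun i _ => (hω i).le,
      ENNReal.ofReal_lt_ofReal_iff (Real.exp_pos _)] at h
    rw [← Real.log_prod fun i _ => (hω i).ne']
    exact (Real.log_lt_iff_lt_exp (Finset.prod_pos fun i _ => hω i)).2 h
  have hN := le_coveringNumber_of_density P hg.ennreal_ofReal hI (lam := lam) hsub
  have hcc : ENNReal.ofReal (1 - lam) - ENNReal.ofReal c = ENNReal.ofReal c := by
    rw [← ENNReal.ofReal_sub _ hc.le]
    congr 1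
    rw [hc_def]; ring
  have hpow : 0 < a ^ l := pow_pos ha l
  rw [hcc, ← ENNReal.ofReal_mul (Real.exp_pos _).le, ← ENNReal.ofReal_pow ha.le,
    ← ENNReal.ofReal_div_of_pos hpow] at hN
  have hlogN := ENNReal.log_monotone hN
  rw [ENNReal.log_ofReal_of_pos (by positivity), Real.log_div (by positivity) hpow.ne',
    Real.log_mul (by positivity) hc.ne', Real.log_exp, Real.log_pow] at hlogN
  rw [rate]
  refine le_trans ?_ (EReal.div_le_div_right_of_nonneg (by positivity) hlogN)
  rw [← EReal.coe_coe_eq_natCast, ← EReal.coe_div, EReal.coe_le_coe_iff]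
  have : (l * (L - ε) + Real.log c - l * Real.log a) / l =
      L - ε - Real.log a + Real.log c / l := by
    field_simp
    ring
  rw [this]
  linarith [hε_def]

end Density

/-! ### Lifts of circle maps -/

/-- The lift of `f` whose translation number is the rotation number of `f`. -/
theorem exists_isLift_translationNumber_eq {f : UnitAddCircle → UnitAddCircle}
    (hf : IsMonotoneDegreeOne f) :
    ∃ F : CircleDeg1Lift, IsLift F f ∧ F.translationNumber = rotationNumber hf := by
  obtain ⟨F, hF⟩ := hf
  have hfl : IsMonotoneDegreeOne f := ⟨F, hF⟩
  -- Translating by this integer replaces the translation number by its fractional part.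
  set m : ℤ := -⌊F.translationNumber⌋
  have happ (x : ℝ) : ((CircleDeg1Lift.translate (Multiplicative.ofAdd (m : ℝ)) : CircleDeg1Lift) *
      F) x = m + F x := by simp
  refine ⟨CircleDeg1Lift.translate (Multiplicative.ofAdd (m : ℝ)) * F, ⟨?_, fun x => ?_⟩, ?_⟩
  · rw [show ⇑((CircleDeg1Lift.translate (Multiplicative.ofAdd (m : ℝ)) : CircleDeg1Lift) * F) =
      fun x => m + F x from funext happ]
    exact continuous_const.add hF.1
  · have hm : ((m : ℝ) : UnitAddCircle) = 0 :=
      (AddCircle.coe_eq_zero_iff (1 : ℝ)).2 ⟨m, by simp⟩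
    rw [happ, AddCircle.coe_add, hF.2, hm, zero_add]
  · have hcomm : Commute
        (CircleDeg1Lift.translate (Multiplicative.ofAdd (m : ℝ)) : CircleDeg1Lift) F := by
      ext x
      simp
    rw [rotationNumber_eq hfl hF, CircleDeg1Lift.translationNumber_mul_of_commute hcomm,
      CircleDeg1Lift.translationNumber_translate, Int.fract]
    simp only [m, Int.cast_neg]
    ring

theorem IsLift.injective {f : UnitAddCircle → UnitAddCircle} {F : CircleDeg1Lift}
    (hF : IsLift F f) (hf : Function.Injective f) : Function.Injective F := by
  intro x y hxy
  have h : ((x - y : ℝ) : UnitAddCircle) = 0 := by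
    rw [AddCircle.coe_sub, sub_eq_zero]
    exact hf (by rw [← hF.2, ← hF.2, hxy])
  obtain ⟨n, hn⟩ := (AddCircle.coe_eq_zero_iff (1 : ℝ)).1 h
  have hx : x = y + n := by
    simp only [zsmul_eq_mul, mul_one] at hn
    linarith
  rw [hx, F.map_add_int] at hxy
  rw [hx]
  linarith

theorem IsLift.surjective {f : UnitAddCircle → UnitAddCircle} {F : CircleDeg1Lift}
    (hF : IsLift F f) : Function.Surjective F :=
  F.continuous_iff_surjective.1 hF.1

/-- A degree one map of the line descends to the circle. -/
theorem exists_isLift {F : CircleDeg1Lift} (hF : Continuous F) :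
    ∃ g : UnitAddCircle → UnitAddCircle, IsLift F g := by
  have hp : Function.Periodic (fun x : ℝ => ((F x : ℝ) : UnitAddCircle)) 1 := fun x => by
    beta_reduce
    rw [F.map_add_one, AddCircle.coe_add, AddCircle.coe_period, add_zero]
  exact ⟨hp.lift, hF, fun x => (hp.lift_coe x).symm⟩

/-- A monotone semiconjugacy to an irrational translation is continuous. -/
theorem continuous_of_semiconj_translate {Γ F : CircleDeg1Lift} {α : ℝ} (hα : Irrational α)
    (hF : Function.Surjective F) (h : ∀ x, Γ (F x) = Γ x + α) : Continuous Γ := by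
  refine Γ.monotone.continuous_of_denseRange ?_
  have hd : Dense (AddSubgroup.closure {α, (1 : ℝ)} : Set ℝ) :=
    dense_addSubgroupClosure_pair_iff.2 (by simpa using hα)
  -- The range is stable under both generators and their negatives; stability under `-α` is where
  -- surjectivity of `F` enters.
  have hsub : ∀ t ∈ AddSubgroup.closure {α, (1 : ℝ)},
      ∀ y ∈ Set.range Γ, y + t ∈ Set.range Γ := by
    intro t ht
    induction ht using AddSubgroup.closure_induction'' with
    | mem t ht =>
      rintro _ ⟨x, rfl⟩
      rcases ht with rfl | rfl
      · exact ⟨F x, h x⟩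
      · exact ⟨x + 1, Γ.map_add_one x⟩
    | neg_mem t ht =>
      rintro _ ⟨x, rfl⟩
      rcases ht with rfl | rfl
      · obtain ⟨z, rfl⟩ := hF x
        exact ⟨z, by rw [h]; ring⟩
      · exact ⟨x - 1, by simpa [sub_eq_add_neg] using Γ.map_sub_int x 1⟩
    | zero => intro y hy; rwa [add_zero]
    | add s t _ _ hs ht => intro y hy; rw [← add_assoc]; exact ht _ (hs _ hy)
  have : Dense ((fun t => Γ 0 + t) '' (AddSubgroup.closure {α, (1 : ℝ)} : Set ℝ)) :=
    (Homeomorph.addLeft (Γ 0)).surjective.denseRange.dense_image (by fun_prop) hd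
  refine this.mono ?_
  rintro _ ⟨t, ht, rfl⟩
  exact hsub t ht _ ⟨0, rfl⟩

/-- An orientation-preserving homeomorphism of irrational rotation number is monotonically
semiconjugate to the rotation. -/
theorem exists_isMonotoneSemiconjugacy (f : UnitAddCircle ≃ₜ UnitAddCircle)
    (hf : IsMonotoneDegreeOne f) (hα : Irrational (rotationNumber hf)) :
    ∃ G, IsMonotoneSemiconjugacy f (rotationNumber hf) G := by
  obtain ⟨F, hF, hτ⟩ := exists_isLift_translationNumber_eq hf
  set α := rotationNumber hf
  have hbij : Function.Bijective F := ⟨hF.injective f.injective, hF.surjective⟩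
  -- This `Γ` is monotone of degree one but not yet known to be continuous.
  obtain ⟨Γ, hΓ⟩ := CircleDeg1Lift.semiconj_of_bijective_of_translationNumber_eq hbij
    (CircleDeg1Lift.isUnit_iff_bijective.1
      (CircleDeg1Lift.translate (Multiplicative.ofAdd α)).isUnit)
    (by rw [hτ, CircleDeg1Lift.translationNumber_translate])
  have hsemi (x : ℝ) : Γ (F x) = Γ x + α := by
    rw [hΓ x, CircleDeg1Lift.translate_apply, add_comm]
  obtain ⟨G, hG⟩ := exists_isLift (continuous_of_semiconj_translate hα hbij.2 hsemi)
  refine ⟨G, ⟨Γ, hG⟩, fun y => ?_⟩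
  obtain ⟨x, rfl⟩ := QuotientAddGroup.mk_surjective y
  change G (f (x : UnitAddCircle)) = G (x : UnitAddCircle) + _
  rw [← hF.2, ← hG.2, ← hG.2, hsemi, AddCircle.coe_add]

/-- The lifts of a semiconjugacy to the rotation are semiconjugacies to the translation. -/
theorem IsLift.semiconj_translate {f G : UnitAddCircle → UnitAddCircle} {F Γ : CircleDeg1Lift}
    (hF : IsLift F f) (hΓ : IsLift Γ G)
    (h : ∀ x, G (f x) = G x + (F.translationNumber : UnitAddCircle)) (x : ℝ) :
    Γ (F x) = Γ x + F.translationNumber := by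
  set α := F.translationNumber with hα
  have h₁ : IsLift (Γ * F) (G ∘ f) :=
    ⟨hΓ.1.comp hF.1, fun x => by rw [CircleDeg1Lift.mul_apply, hΓ.2, hF.2]; rfl⟩
  have happ (x : ℝ) : ((CircleDeg1Lift.translate (Multiplicative.ofAdd α) : CircleDeg1Lift) *
      Γ) x = α + Γ x := by simp
  have h₂ : IsLift (CircleDeg1Lift.translate (Multiplicative.ofAdd α) * Γ) (G ∘ f) := by
    refine ⟨?_, fun x => ?_⟩
    · rw [show ⇑((CircleDeg1Lift.translate (Multiplicative.ofAdd α) : CircleDeg1Lift) * Γ) =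
        fun x => α + Γ x from funext happ]
      exact continuous_const.add hΓ.1
    · rw [happ, AddCircle.coe_add, hΓ.2, Function.comp_apply, h, add_comm]
  -- Thus `Γ` semiconjugates `F` to the translation by `α + m`; invariance of the translation number
  -- forces `m = 0`.
  obtain ⟨m, hm⟩ := IsLift.exists_int h₁ h₂
  have hm' (x : ℝ) : Γ (F x) = α + Γ x + m := by
    have := hm x
    rwa [happ, CircleDeg1Lift.mul_apply] at this
  have hτ : F.translationNumber =
      ((CircleDeg1Lift.translate (Multiplicative.ofAdd (α + m)) :
        CircleDeg1Lift)).translationNumber :=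
    CircleDeg1Lift.translationNumber_eq_of_semiconj (f := Γ) fun x => by
      rw [hm', CircleDeg1Lift.translate_apply]; ring
  rw [CircleDeg1Lift.translationNumber_translate, ← hα] at hτ
  rw [hm']
  linarith

/-! ### The derivative of a monotone circle map -/

/-- Lebesgue's theorem on monotone functions, applied to the lift and carried over from the
fundamental domain `(0, 1]`. -/
theorem IsLift.circleDifferentiableAt_ae {G : UnitAddCircle → UnitAddCircle} {Γ : CircleDeg1Lift}
    (hΓ : IsLift Γ G) : ∀ᵐ x : UnitAddCircle, CircleDifferentiableAt G x := by
  have hr : ∀ᵐ t : Set.Ioc (0 : ℝ) (0 + 1) ∂(Measure.comap Subtype.val volume),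
      DifferentiableAt ℝ Γ t := by
    rw [← (MeasurableEmbedding.subtype_coe measurableSet_Ioc).ae_map_iff,
      map_comap_subtype_coe measurableSet_Ioc]
    exact ae_restrict_of_ae Γ.monotone.ae_differentiableAt
  filter_upwards [(AddCircle.measurePreserving_equivIoc 1 (a := 0)).quasiMeasurePreserving.ae hr]
    with x hx
  set t : ℝ := (AddCircle.equivIoc 1 0 x : ℝ)
  have ht : (t : UnitAddCircle) = x := (AddCircle.equivIoc 1 0).symm_apply_apply x
  rw [← ht]
  refine DifferentiableAt.congr_of_eventuallyEq ?_ (displacement_eventuallyEq hΓ t)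
  refine DifferentiableAt.sub_const ?_ _
  rw [← add_zero t] at hx
  exact hx.comp (0 : ℝ) (differentiableAt_id.const_add t)

theorem IsLift.measurable_circleDeriv {G : UnitAddCircle → UnitAddCircle} {Γ : CircleDeg1Lift}
    (hΓ : IsLift Γ G) : Measurable (circleDeriv G) := by
  have : circleDeriv G = fun x => deriv Γ (AddCircle.equivIoc (1 : ℝ) 0 x : ℝ) := by
    funext x
    rw [← circleDeriv_coe hΓ]
    congr 1
    exact ((AddCircle.equivIoc (1 : ℝ) 0).symm_apply_apply x).symm
  rw [this]
  exact (measurable_deriv Γ).comp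
    (measurable_subtype_coe.comp (AddCircle.measurableEquivIoc (1 : ℝ) 0).measurable)

/-- The integral of the derivative of a monotone function is at most its increment. -/
theorem setLIntegral_deriv_le_of_monotone {Γ : ℝ → ℝ} (hΓ : Monotone Γ) (a b : ℝ) :
    ∫⁻ x in Set.Ioc a b, ENNReal.ofReal (deriv Γ x) ≤ ENNReal.ofReal (Γ b - Γ a) := by
  set D : Set ℝ := {x | DifferentiableAt ℝ Γ x}
  have hD : MeasurableSet D := measurableSet_of_differentiableAt ℝ Γ
  have hae : (Set.Ioc a b ∩ D : Set ℝ) =ᵐ[volume] Set.Ioc a b :=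
    inter_ae_eq_left_of_ae_eq_univ (eventuallyEq_univ.2 hΓ.ae_differentiableAt)
  -- The integral is the measure of the image of the differentiability points, which lies in `[Γ a,
  -- Γ b]`. The image of the remaining null set may have positive measure, hence only an inequality.
  rw [← setLIntegral_congr hae, lintegral_deriv_eq_volume_image_of_monotoneOn
    (measurableSet_Ioc.inter hD) (fun x hx => hx.2.hasDerivAt.hasDerivWithinAt) (hΓ.monotoneOn _),
    ← Real.volume_Icc]
  refine measure_mono ?_
  rintro _ ⟨x, hx, rfl⟩
  exact ⟨hΓ hx.1.1.le, hΓ hx.1.2⟩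

theorem IsLift.lintegral_circleDeriv_le {G : UnitAddCircle → UnitAddCircle} {Γ : CircleDeg1Lift}
    (hΓ : IsLift Γ G) : ∫⁻ x, ENNReal.ofReal (circleDeriv G x) ≤ 1 := by
  rw [← AddCircle.lintegral_preimage 1 0]
  simp only [circleDeriv_coe hΓ]
  refine (setLIntegral_deriv_le_of_monotone Γ.monotone _ _).trans ?_
  rw [Γ.map_add_one, add_sub_cancel_left, ENNReal.ofReal_one]

theorem isOpen_coe_image_Ioo (x y : ℝ) :
    IsOpen (((↑) : ℝ → UnitAddCircle) '' Set.Ioo x y) :=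
  QuotientAddGroup.isOpenMap_coe _ isOpen_Ioo

theorem IsLift.setLIntegral_circleDeriv_le {G : UnitAddCircle → UnitAddCircle}
    {Γ : CircleDeg1Lift} (hΓ : IsLift Γ G) {x y : ℝ} (hy : y < x + 1) :
    ∫⁻ z in ((↑) : ℝ → UnitAddCircle) '' Set.Ioo x y, ENNReal.ofReal (circleDeriv G z) ≤
      ENNReal.ofReal (Γ y - Γ x) := by
  have hJ := (isOpen_coe_image_Ioo x y).measurableSet
  rw [← (UnitAddCircle.measurePreserving_mk x).setLIntegral_comp_preimage hJ
    hΓ.measurable_circleDeriv.ennreal_ofReal,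
    Measure.restrict_restrict (AddCircle.measurable_mk' hJ)]
  simp only [circleDeriv_coe hΓ]
  refine (lintegral_mono_set ?_).trans (setLIntegral_deriv_le_of_monotone Γ.monotone x y)
  -- Since `y < x + 1`, the projection is injective on `(x, x + 1]`, so the arc has no preimage
  -- there outside `(x, y)`.
  rintro t ⟨⟨s, hs, hst⟩, ht⟩
  have : s = t := (AddCircle.coe_eq_coe_iff_of_mem_Ioc (p := (1 : ℝ)) (a := x)
    ⟨hs.1, (hs.2.trans hy).le⟩ ht).1 hst
  exact this ▸ ⟨hs.1, hs.2.le⟩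

/-- From `log t ≤ t` for `t > 0`; as `G'` has total mass at most `1`, the positive part of `log G'`
is integrable. -/
theorem posLogIntegral_le {Ω : Type*} [MeasurableSpace Ω] (P : Measure Ω) (g : Ω → ℝ) :
    posLogIntegral P g ≤ ∫⁻ x, ENNReal.ofReal (g x) ∂P := by
  refine lintegral_mono fun x => ?_
  rcases le_or_gt (g x) 0 with h | h
  · simp [ENNReal.ofReal_of_nonpos h]
  · rw [ENNReal.log_ofReal_of_pos h, EReal.toENNReal_of_ne_top (EReal.coe_ne_top _),
      EReal.toReal_coe]
    exact ENNReal.ofReal_le_ofReal (Real.log_le_self h.le)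

end ArcEntropy

theorem mainTheorem8 (f : UnitAddCircle ≃ₜ UnitAddCircle)
    (hf : ArcEntropy.IsMonotoneDegreeOne f)
    (hα : Irrational (ArcEntropy.rotationNumber hf)) :
    (∃ G : UnitAddCircle → UnitAddCircle,
      ArcEntropy.IsMonotoneSemiconjugacy f (ArcEntropy.rotationNumber hf) G) ∧
    ∀ G : UnitAddCircle → UnitAddCircle,
      ArcEntropy.IsMonotoneSemiconjugacy f (ArcEntropy.rotationNumber hf) G →
      (∀ᵐ x : UnitAddCircle, ArcEntropy.CircleDifferentiableAt G x) ∧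
      ArcEntropy.posLogIntegral volume (ArcEntropy.circleDeriv G) ≠ ⊤ ∧
      (∀ lam : ℝ, 0 < lam → lam < 1 →
        ArcEntropy.logIntegral volume (ArcEntropy.circleDeriv G)
            - (Real.log (ArcEntropy.rotationNumber hf) : EReal)
          ≤ ArcEntropy.lowerEntropy (ArcEntropy.arcSystem f) volume lam) ∧
      (∀ h : EReal, ArcEntropy.HasEntropy (ArcEntropy.arcSystem f) volume h →
        ArcEntropy.logIntegral volume (ArcEntropy.circleDeriv G)
            - (Real.log (ArcEntropy.rotationNumber hf) : EReal) ≤ h) := by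
  refine ⟨ArcEntropy.exists_isMonotoneSemiconjugacy f hf hα, ?_⟩
  rintro G ⟨⟨Γ, hΓ⟩, hG⟩
  obtain ⟨F, hF, hτ⟩ := ArcEntropy.exists_isLift_translationNumber_eq hf
  have hα0 : 0 < ArcEntropy.rotationNumber hf :=
    lt_of_le_of_ne (Int.fract_nonneg _) hα.ne_zero.symm
  have hα1 : ArcEntropy.rotationNumber hf < 1 := Int.fract_lt_one _
  have hpos : ArcEntropy.posLogIntegral volume (ArcEntropy.circleDeriv G) ≠ ⊤ :=
    ne_top_of_le_ne_top ENNReal.one_ne_top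
      ((ArcEntropy.posLogIntegral_le _ _).trans hΓ.lintegral_circleDeriv_le)
  have harc : ∀ J ∈ ArcEntropy.arcSystem f, MeasurableSet J ∧
      ∫⁻ x in J, ENNReal.ofReal (ArcEntropy.circleDeriv G x) ≤
        ENNReal.ofReal (ArcEntropy.rotationNumber hf) := by
    rintro _ ⟨y, rfl⟩
    obtain ⟨x, rfl⟩ := QuotientAddGroup.mk_surjective y
    -- A translation number strictly between `0` and `1` gives `x < F x < x + 1` for every `x`, so
    -- the arc is the injective image of `(x, F x)`.
    have h0 : x < F x := by
      simpa using F.lt_map_of_int_lt_translationNumber (n := 0) (by simpa [hτ] using hα0) x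
    have h1 : F x < x + 1 := by
      simpa using F.map_lt_of_translationNumber_lt_int (n := 1) (by simpa [hτ] using hα1) x
    have hJ : Set.cIoo (x : UnitAddCircle) (f x) =
        ((↑) : ℝ → UnitAddCircle) '' Set.Ioo x (F x) := by
      rw [← hF.2]
      simpa using ArcEntropy.cIoo_coe x (F x - x) (by linarith) (by linarith)
    change MeasurableSet (Set.cIoo (x : UnitAddCircle) (f x)) ∧
      ∫⁻ z in Set.cIoo (x : UnitAddCircle) (f x), _ ≤ _
    rw [hJ]
    refine ⟨(ArcEntropy.isOpen_coe_image_Ioo _ _).measurableSet,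
      (hΓ.setLIntegral_circleDeriv_le h1).trans_eq ?_⟩
    -- The increment `Γ (F x) - Γ x` is exactly `α`, whatever `x` is.
    rw [hF.semiconj_translate hΓ (by rwa [hτ]), add_sub_cancel_left, hτ]
  have : IsProbabilityMeasure (volume : Measure UnitAddCircle) :=
    ⟨by rw [AddCircle.measure_univ, ENNReal.ofReal_one]⟩
  have hlow (lam : ℝ) (hlam : lam < 1) :=
    ArcEntropy.le_lowerEntropy_of_density volume hΓ.measurable_circleDeriv hα0 harc hpos hlam
  refine ⟨hΓ.circleDifferentiableAt_ae, hpos, fun lam _ hlam => hlow lam hlam, fun h hh => ?_⟩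
  rw [← (hh (1 / 2) (by norm_num) (by norm_num)).1]
  exact hlow _ (by norm_num)
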